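/- Let $\mathbb F$ be a field and let $A(s),P(s)\in\mathbb F[s]^{n\times n}$ be matrix pencils, i.e. square polynomial matrices whose entries have degree at most one. Let $r$ be the rank of $P(s)$ over the field of fractions $\mathbb F(s)$. Assume that $A(s)$ and $A(s)+P(s)$ are regular, i.e. $\det A(s)\neq 0$ and $\det(A(s)+P(s))\neq 0$ as polynomials. Let $\alpha_1(s)\mid\dots\mid\alpha_n(s)$ be the invariant factors of $A(s)$ (the monic diagonal entries of its Smith form) and $p(s)=\det(A(s)+P(s))$. Write $A(s)=A_0+sA_1$ with $A_0,A_1\in\mathbb F^{n\times n}$, let $\bar\alpha_1(t)\mid\dots\mid\bar\alpha_n(t)$ be the invariant factors of $tA_0+A_1$, and let $m_1(\infty,A)\le\dots\le m_n(\infty,A)$ be the partial multiplicities of $A(s)$ at infinity, i.e. $m_i(\infty,A)$ is the exponent of the highest power of $t$ dividing $\bar\alpha_i(t)$. Put $$\mu_a(\infty,A)=\sum_{i=1}^{n}m_i(\infty,A),\qquad M_r(\infty,A)=\sum_{i=n-r+1}^{n}m_i(\infty,A).$$ Then $$\alpha_1(s)\cdots\alpha_{n-r}(s)\mid p(s)\qquad\text{and}\qquad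 \mu_a(\infty,A)-M_r(\infty,A)\le n-\deg p(s).$$ -/

import Mathlib

open Polynomial

/-- `γ 0, …, γ (n-1)` are the invariant factors of the square polynomial matrix `G`, i.e.
`diag(γ 0, …, γ (n-1))` is the Smith form of `G`: the `γ i` are monic or zero, each divides the
following ones (so zeros, if any, come last), and `G = U * diag γ * V` with `U`, `V` unimodular
(units of the ring of square polynomial matrices).  If `G` has normal rank `ρ`, exactly the first
`ρ` of the `γ i` are nonzero, in accordance with the convention that the invariant factors of
index larger than `ρ` are `0`. -/
structure IsInvariantFactors {F : Type*} [Field F] {n : ℕ}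
    (G : Matrix (Fin n) (Fin n) F[X]) (γ : Fin n → F[X]) : Prop where
  monic_or_zero : ∀ i, (γ i).Monic ∨ γ i = 0
  dvd : ∀ i j, i ≤ j → γ i ∣ γ j
  equiv : ∃ U V : Matrix (Fin n) (Fin n) F[X],
    IsUnit U ∧ IsUnit V ∧ G = U * Matrix.diagonal γ * V

/-- If a square polynomial matrix is nonzero, some equivalent matrix has an entry dividing all
entries. -/
theorem exists_equiv_entry_dvd {F : Type*} [Field F] {n : ℕ}
    (G : Matrix (Fin n) (Fin n) F[X]) (hG : G ≠ 0) :
    ∃ U V H : Matrix (Fin n) (Fin n) F[X], IsUnit U ∧ IsUnit V ∧ G = U * H * V ∧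
      ∃ i j, H i j ≠ 0 ∧ ∀ k l, H i j ∣ H k l := by
  classical
  let E : Matrix (Fin n) (Fin n) F[X] → Prop := fun H =>
    ∃ U V : Matrix (Fin n) (Fin n) F[X], IsUnit U ∧ IsUnit V ∧ G = U * H * V
  have hT : ∀ i j (c : F[X]), i ≠ j →
      IsUnit (Matrix.transvection i j c : Matrix (Fin n) (Fin n) F[X]) := by
    intro i j c h
    rw [Matrix.isUnit_iff_isUnit_det, Matrix.det_transvection_of_ne i j h c]
    exact isUnit_one
  have hTT : ∀ i j (c : F[X]), i ≠ j →
      (Matrix.transvection i j (-c) : Matrix (Fin n) (Fin n) F[X]) *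
        Matrix.transvection i j c = 1 := by
    intro i j c h
    rw [Matrix.transvection_mul_transvection_same i j h]
    simp
  have hTT' : ∀ i j (c : F[X]), i ≠ j →
      (Matrix.transvection i j c : Matrix (Fin n) (Fin n) F[X]) *
        Matrix.transvection i j (-c) = 1 := by
    intro i j c h
    rw [Matrix.transvection_mul_transvection_same i j h]
    simp
  have hrow : ∀ H, E H → ∀ i j c, i ≠ j → E (Matrix.transvection i j c * H) := by
    rintro H ⟨U, V, hU, hV, h⟩ i j c hij
    refine ⟨U * Matrix.transvection i j (-c), V, hU.mul (hT i j _ hij), hV, ?_⟩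
    rw [h, ← mul_assoc (U * _), mul_assoc U _ (Matrix.transvection i j c), hTT i j c hij, mul_one]
  have hcol : ∀ H, E H → ∀ i j c, i ≠ j → E (H * Matrix.transvection i j c) := by
    rintro H ⟨U, V, hU, hV, h⟩ i j c hij
    refine ⟨U, Matrix.transvection i j (-c) * V, hU, (hT i j _ hij).mul hV, ?_⟩
    rw [h, mul_assoc, mul_assoc, mul_assoc, ← mul_assoc (Matrix.transvection i j c),
      hTT' i j c hij, one_mul]
  have hex : ∃ d : ℕ, ∃ H, E H ∧ ∃ i j, H i j ≠ 0 ∧ (H i j).natDegree = d := by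
    have : ∃ i j, G i j ≠ 0 := by
      by_contra hcon
      push Not at hcon
      exact hG (by ext i j : 1; simpa using hcon i j)
    obtain ⟨i, j, hij⟩ := this
    exact ⟨_, G, ⟨1, 1, isUnit_one, isUnit_one, by simp⟩, i, j, hij, rfl⟩
  obtain ⟨H, hH, i, j, hne, hdeg⟩ := Nat.find_spec hex
  have hmin : ∀ K, E K → ∀ k l a, K k l = a % H i j → K k l = 0 := by
    intro K hK k l a hkl
    by_contra h0
    have h1 : (K k l).degree < (H i j).degree := by
      rw [hkl]; exact EuclideanDomain.mod_lt _ hne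
    have h2 := Polynomial.natDegree_lt_natDegree h0 h1
    rw [hdeg] at h2
    exact Nat.find_min hex h2 ⟨K, hK, k, l, h0, rfl⟩
  have hcd : ∀ K, E K → ∀ k l, K k l = H i j → ∀ l', H i j ∣ K k l' := by
    intro K hK k l hkl l'
    by_cases hll : l = l'
    · rw [← hll, hkl]
    have hE := hcol K hK l l' (-(K k l' / H i j)) hll
    have hv : (K * Matrix.transvection l l' (-(K k l' / H i j))) k l' = K k l' % H i j := by
      rw [Matrix.mul_transvection_apply_same, hkl, EuclideanDomain.mod_eq_sub_mul_div]
      ring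
    have := hmin _ hE k l' _ hv
    rw [hv] at this
    exact EuclideanDomain.mod_eq_zero.1 this
  have hrd : ∀ K, E K → ∀ k l, K k l = H i j → ∀ k', H i j ∣ K k' l := by
    intro K hK k l hkl k'
    by_cases hkk : k' = k
    · rw [hkk, hkl]
    have hE := hrow K hK k' k (-(K k' l / H i j)) hkk
    have hv : (Matrix.transvection k' k (-(K k' l / H i j)) * K) k' l = K k' l % H i j := by
      rw [Matrix.transvection_mul_apply_same, hkl, EuclideanDomain.mod_eq_sub_mul_div]
      ring
    have := hmin _ hE k' l _ hv
    rw [hv] at this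
    exact EuclideanDomain.mod_eq_zero.1 this
  obtain ⟨U, V, hU, hV, hG'⟩ := id hH
  refine ⟨U, V, H, hU, hV, hG', i, j, hne, fun k l => ?_⟩
  by_cases hki : k = i
  · rw [hki]; exact hcd H hH i j rfl l
  obtain ⟨w, hw⟩ := hrd H hH i j rfl k
  have hE := hrow H hH k i (1 - w) hki
  have h1 := hcd _ hE k j (by
    rw [Matrix.transvection_mul_apply_same, hw]; ring) l
  rw [Matrix.transvection_mul_apply_same] at h1
  exact (dvd_add_left (Dvd.dvd.mul_left (hcd H hH i j rfl l) _)).1 h1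

/-- Smith form without the normalization of the diagonal entries. -/
theorem exists_diagonal_equiv {F : Type*} [Field F] : ∀ {n : ℕ}
    (G : Matrix (Fin n) (Fin n) F[X]), ∃ γ : Fin n → F[X], (∀ i j, i ≤ j → γ i ∣ γ j) ∧
      ∃ U V : Matrix (Fin n) (Fin n) F[X], IsUnit U ∧ IsUnit V ∧
        G = U * Matrix.diagonal γ * V := by
  classical
  intro n
  induction n with
  | zero => exact fun G => ⟨0, fun i => i.elim0, 1, 1, isUnit_one, isUnit_one,
      Subsingleton.elim _ _⟩
  | succ n ih =>
    intro G
    by_cases hG : G = 0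
    · refine ⟨0, fun _ _ _ => dvd_rfl, 1, 1, isUnit_one, isUnit_one, ?_⟩
      subst hG
      ext i j : 1
      simp
    obtain ⟨U, V, H, hU, hV, hGH, i, j, hne, hd⟩ := exists_equiv_entry_dvd G hG
    let f : Fin (n + 1) ≃ Option (Fin n) := finSuccEquiv n
    let g : Option (Fin n) ≃ Unit ⊕ Fin n :=
      (Equiv.optionEquivSumPUnit (Fin n)).trans (Equiv.sumComm _ _)
    let e : Fin (n + 1) ≃ Unit ⊕ Fin n := f.trans g
    let e₁ : Fin (n + 1) ≃ Unit ⊕ Fin n := (finSuccEquiv' i).trans g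
    let e₂ : Fin (n + 1) ≃ Unit ⊕ Fin n := (finSuccEquiv' j).trans g
    let d := H i j
    choose q hq using hd
    let w : Matrix (Fin n) Unit F[X] := Matrix.of fun k _ => q (e₁.symm (Sum.inr k)) j
    let v : Matrix Unit (Fin n) F[X] := Matrix.of fun _ l => q i (e₂.symm (Sum.inr l))
    let N : Matrix (Fin n) (Fin n) F[X] := Matrix.of fun k l =>
      q (e₁.symm (Sum.inr k)) (e₂.symm (Sum.inr l)) -
        q (e₁.symm (Sum.inr k)) j * q i (e₂.symm (Sum.inr l))
    obtain ⟨γ, hγ, U', V', hU', hV', hN⟩ := ih N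
    have he₁ : e₁.symm (Sum.inl ()) = i := by simp [e₁, g]
    have he₂ : e₂.symm (Sum.inl ()) = j := by simp [e₂, g]
    have he0 : e 0 = Sum.inl () := by simp [e, f, g]
    have heS : ∀ k : Fin n, e k.succ = Sum.inr k := by intro k; simp [e, f, g]
    let γ' : Fin (n + 1) → F[X] := Fin.cons d (fun k => d * γ k)
    let L : Matrix (Unit ⊕ Fin n) (Unit ⊕ Fin n) F[X] := Matrix.fromBlocks 1 0 w U'
    let R : Matrix (Unit ⊕ Fin n) (Unit ⊕ Fin n) F[X] := Matrix.fromBlocks 1 v 0 V'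
    have hL : IsUnit L := by
      rw [Matrix.isUnit_iff_isUnit_det, Matrix.det_fromBlocks_zero₁₂]
      simpa using (Matrix.isUnit_iff_isUnit_det _).1 hU'
    have hR : IsUnit R := by
      rw [Matrix.isUnit_iff_isUnit_det, Matrix.det_fromBlocks_zero₂₁]
      simpa using (Matrix.isUnit_iff_isUnit_det _).1 hV'
    have hγ' : (Matrix.diagonal γ').submatrix e.symm e.symm =
        Matrix.fromBlocks (d • (1 : Matrix Unit Unit F[X])) 0 0 (d • Matrix.diagonal γ) := by
      rw [Matrix.submatrix_diagonal_equiv]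
      ext a b : 1
      have h0 : e.symm (Sum.inl ()) = 0 := by rw [Equiv.symm_apply_eq, he0]
      have hS : ∀ k : Fin n, e.symm (Sum.inr k) = k.succ := by
        intro k; rw [Equiv.symm_apply_eq, heS]
      rcases a with a | a <;> rcases b with b | b
      · simp [γ', h0]
      · simp
      · simp
      · by_cases hab : a = b
        · subst hab; simp [γ', hS]
        · simp [hab]
    have hH : H.submatrix e₁.symm e₂.symm =
        L * (Matrix.diagonal γ').submatrix e.symm e.symm * R := by
      rw [hγ', Matrix.fromBlocks_multiply, Matrix.fromBlocks_multiply]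
      have hN' : U' * (d • Matrix.diagonal γ) * V' = d • N := by
        rw [hN, Matrix.mul_smul, Matrix.smul_mul]
      ext a b : 1
      rcases a with a | a <;> rcases b with b | b
      · simp [he₁, he₂, d]
      · simp only [Matrix.submatrix_apply, Matrix.fromBlocks_apply₁₂, he₁]
        rw [hq i]
        simp [v, d]
      · simp only [Matrix.submatrix_apply, Matrix.fromBlocks_apply₂₁, he₂]
        rw [hq _ j]
        simp [w, d]
      · simp only [Matrix.submatrix_apply, Matrix.fromBlocks_apply₂₂]
        simp only [Matrix.mul_zero, zero_add, add_zero]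
        rw [hN', hq]
        simp [w, v, d, N, Matrix.mul_apply]
        ring
    refine ⟨γ', ?_, U * L.submatrix e₁ e, R.submatrix e e₂ * V,
      hU.mul ((Matrix.isUnit_submatrix_equiv e₁ e).2 hL),
      ((Matrix.isUnit_submatrix_equiv e e₂).2 hR).mul hV, ?_⟩
    · intro a b hab
      induction a using Fin.cases with
      | zero =>
        induction b using Fin.cases with
        | zero => exact dvd_rfl
        | succ b => simp [γ']
      | succ a =>
        induction b using Fin.cases with
        | zero => simp at hab
        | succ b =>
          simp only [γ', Fin.cons_succ]
          exact mul_dvd_mul_left d (hγ a b (by simpa using hab))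
    · have h2 : H = L.submatrix e₁ e * Matrix.diagonal γ' * R.submatrix e e₂ := by
        have h3 : H = (H.submatrix e₁.symm e₂.symm).submatrix e₁ e₂ := by
          simp [Matrix.submatrix_submatrix]
        rw [h3, hH, ← Matrix.submatrix_mul_equiv _ _ e₁ e e₂,
          ← Matrix.submatrix_mul_equiv _ _ e₁ e e]
        simp [Function.comp_assoc]
      rw [hGH]
      conv_lhs => rw [h2]
      simp only [Matrix.mul_assoc]

/-- Every square polynomial matrix has a Smith form. -/
theorem exists_isInvariantFactors {F : Type*} [Field F] {n : ℕ}
    (G : Matrix (Fin n) (Fin n) F[X]) : ∃ γ, IsInvariantFactors G γ := by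
  classical
  obtain ⟨γ, hγ, U, V, hU, hV, h⟩ := exists_diagonal_equiv G
  refine ⟨fun i => normalize (γ i), ⟨?_, ?_, U,
    Matrix.diagonal (fun i => ((normUnit (γ i))⁻¹ : F[X]ˣ).val) * V, hU, ?_, ?_⟩⟩
  · intro i
    by_cases h0 : γ i = 0
    · right; simp [h0]
    · left; exact Polynomial.monic_normalize h0
  · intro i j hij
    simpa using hγ i j hij
  · refine IsUnit.mul ?_ hV
    rw [Matrix.isUnit_iff_isUnit_det, Matrix.det_diagonal]
    exact IsUnit.prod_univ_iff.2 fun i => Units.isUnit _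
  · rw [h, ← Matrix.mul_assoc, Matrix.mul_assoc U (Matrix.diagonal _) (Matrix.diagonal _),
      Matrix.diagonal_mul_diagonal]
    congr 3
    ext1 i
    rw [normalize_apply, mul_assoc, Units.mul_inv, mul_one]

/-- The `i`-th invariant factor (numbered from `0`) of a square polynomial matrix, i.e. the `i`-th
diagonal entry of its (unique) Smith form. -/
noncomputable def invariantFactor {F : Type*} [Field F] {n : ℕ}
    (G : Matrix (Fin n) (Fin n) F[X]) : Fin n → F[X] :=
  Classical.choose (exists_isInvariantFactors G)

theorem isInvariantFactors_invariantFactor {F : Type*} [Field F] {n : ℕ}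
    (G : Matrix (Fin n) (Fin n) F[X]) : IsInvariantFactors G (invariantFactor G) :=
  Classical.choose_spec (exists_isInvariantFactors G)

/-- `G` is a matrix pencil: a polynomial matrix of degree at most one. -/
def IsPencil {F : Type*} [Field F] {n : ℕ} (G : Matrix (Fin n) (Fin n) F[X]) : Prop :=
  ∀ i j, (G i j).degree ≤ 1

/-- A square pencil is regular if its determinant is not the zero polynomial. -/
def IsRegularPencil {F : Type*} [Field F] {n : ℕ} (G : Matrix (Fin n) (Fin n) F[X]) : Prop :=
  IsPencil G ∧ G.det ≠ 0

/-- The normal rank of a polynomial matrix: its rank over the field of fractions of `F[X]`. -/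
noncomputable def normalRank {F : Type*} [Field F] {n : ℕ}
    (G : Matrix (Fin n) (Fin n) F[X]) : ℕ :=
  (G.map (algebraMap F[X] (FractionRing F[X]))).rank

/-- The reversal `t G₀ + G₁` of a pencil `G = G₀ + s G₁`. -/
noncomputable def reversal {F : Type*} [Field F] {n : ℕ}
    (G : Matrix (Fin n) (Fin n) F[X]) : Matrix (Fin n) (Fin n) F[X] :=
  (X : F[X]) • G.map (fun g => C (g.coeff 0)) + G.map (fun g => C (g.coeff 1))

/-- The `i`-th partial multiplicity at infinity `mᵢ(∞, G)` (numbered from `0`) of a regular pencil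
`G`.  With `γᵢ` and `γ'ᵢ` the `i`-th invariant factors of `G` and of its reversal, it is the
exponent `q` in `γ'ᵢ(t) = k t ^ q (t ^ deg γᵢ * γᵢ(1/t))`, `k ≠ 0`.  Since the factor in
parentheses has the nonzero value `1` at `t = 0`, `q` is the exact power of `t` in `γ'ᵢ`. -/
noncomputable def partialMultInfty {F : Type*} [Field F] {n : ℕ}
    (G : Matrix (Fin n) (Fin n) F[X]) (i : Fin n) : ℕ :=
  (invariantFactor (reversal G) i).rootMultiplicity 0

/-- The algebraic multiplicity `μₐ(∞, G)`: the sum of all partial multiplicities at infinity. -/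
noncomputable def algMultInfty {F : Type*} [Field F] {n : ℕ}
    (G : Matrix (Fin n) (Fin n) F[X]) : ℕ :=
  ∑ i : Fin n, partialMultInfty G i

/-- `M_r(∞, G)`: the sum of the `r` partial multiplicities at infinity with the largest indices,
i.e. (numbering from `0`) the indices `n - r, …, n - 1`; the partial multiplicities are
nondecreasing in the index, so these are the `r` largest ones. -/
noncomputable def topMultInfty {F : Type*} [Field F] {n : ℕ} (r : ℕ)
    (G : Matrix (Fin n) (Fin n) F[X]) : ℕ :=
  ∑ i : Fin n with n - r ≤ i.val, partialMultInfty G i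

/-! Both claims come from one divisibility: if `G` has invariant factors `γ` and `Q` has normal rank
`r`, the product of the first `n - r` of the `γ i` divides `det (G + Q)`. Writing `G = U * diagonal
γ * V`, unimodular factors reduce this to `det (diagonal γ + Q')`, where `Q'` still has normal rank
`r`. Expand by multilinearity in the rows: a term taking more than `r` rows from `Q'` vanishes, and
any other is divisible by at least `n - r` of the `γ i`, whose product the divisibility chain bounds
below by the first `n - r` (`prod_initial_dvd_det_diagonal_add`).

With `G = A`, `Q = P` this is the finite claim. For infinity, apply it to the reversals: `det
(reversal (A + P))` is `t ^ n * p (1 / t)`, of order `n - deg p` at `0` (`IsPencil.det_reversal`),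
and the normal rank of `P` does not grow under reversal (`IsPencil.normalRank_reversal_le`).
Comparing orders at `0` gives the inequality. -/

/-- A ring homomorphism between fields does not increase the rank of a square matrix. -/
theorem Matrix.rank_map_ringHom_le {K L : Type*} [Field K] [Field L] {n : ℕ} (f : K →+* L)
    (M : Matrix (Fin n) (Fin n) K) : (M.map f).rank ≤ M.rank := by
  obtain ⟨V, U, e, hV, hU, h⟩ := M.exists_rank_normal_form
  have h' : V.map f * M.map f * U.map f =
      (Matrix.fromBlocks (1 : Matrix (Fin M.rank) (Fin M.rank) L) 0 0 0).submatrix e e := by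
    rw [← Matrix.map_mul, ← Matrix.map_mul, h, ← Matrix.submatrix_map, Matrix.fromBlocks_map]
    simp
  have hV' : IsUnit (V.map f).det :=
    (Matrix.isUnit_iff_isUnit_det _).1 (hV.map f.mapMatrix)
  have hU' : IsUnit (U.map f).det :=
    (Matrix.isUnit_iff_isUnit_det _).1 (hU.map f.mapMatrix)
  have hr : (V.map f * M.map f * U.map f).rank = (M.map f).rank := by
    rw [Matrix.rank_mul_eq_left_of_isUnit_det _ _ hU', Matrix.rank_mul_eq_right_of_isUnit_det _ _ hV']
  rw [← hr, h', Matrix.rank_submatrix]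
  -- The block matrix `diag(1, 0)` factors through a space of dimension `M.rank`, which bounds its
  -- rank.
  let k := Fin M.rank
  let l := Fin (Fintype.card (Fin n) - M.rank)
  have hB := Matrix.fromRows_mul_fromCols (1 : Matrix k k L) (0 : Matrix l k L)
    (1 : Matrix k k L) (0 : Matrix k l L)
  simp only [Matrix.mul_one, Matrix.mul_zero] at hB
  rw [← hB]
  exact (Matrix.rank_mul_le_left _ _).trans
    ((Matrix.rank_le_card_width _).trans (Fintype.card_fin _).le)

/-! ### Initial invariant factors and the determinant of a perturbed matrix -/

/-- In a divisibility chain, the product of the first `k` terms divides the product of any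
`k` or more terms. -/
theorem prod_initial_dvd_prod {R : Type*} [CommMonoid R] {n k : ℕ} (γ : Fin n → R)
    (hγ : ∀ i j, i ≤ j → γ i ∣ γ j) (s : Finset (Fin n)) (hs : k ≤ s.card) :
    (∏ i : Fin n with i.val < k, γ i) ∣ ∏ i ∈ s, γ i := by
  obtain ⟨t, ht, hk⟩ := Finset.exists_subset_card_eq hs
  refine dvd_trans ?_ (Finset.prod_dvd_prod_of_subset _ _ _ ht)
  have hkn : k ≤ n := by simpa [hk] using t.card_le_univ
  have h1 : (∏ i : Fin n with i.val < k, γ i) = ∏ j : Fin k, γ (Fin.castLE hkn j) := by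
    symm
    refine Finset.prod_bij (fun j _ => Fin.castLE hkn j) (by simp) (by simp) ?_ (by simp)
    intro b hb
    exact ⟨⟨b, by simpa using hb⟩, by simp, by simp⟩
  have h2 : ∏ i ∈ t, γ i = ∏ j : Fin k, γ (t.orderEmbOfFin hk j) := by
    rw [← Finset.prod_coe_sort]
    exact (Equiv.prod_comp (t.orderIsoOfFin hk).toEquiv fun i : t => γ i).symm
  rw [h1, h2]
  refine Finset.prod_dvd_prod_of_dvd _ _ fun j _ => hγ _ _ ?_
  -- With `t` listed increasingly and indices starting at `0`, its `m`-th element is at least `m`.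
  have key : ∀ m (hm : m < k), m ≤ (t.orderEmbOfFin hk ⟨m, hm⟩).val := by
    intro m
    induction m with
    | zero => simp
    | succ m ih =>
      intro hm
      refine (ih (by omega)).trans_lt ?_
      exact (t.orderEmbOfFin hk).strictMono (by simp)
  exact key j j.2

/-- Otherwise the rows indexed by `s` would be independent over the fraction field; being rows of
`Q`, they would force its rank up to `s.card`. -/
theorem det_eq_zero_of_normalRank_lt {F : Type*} [Field F] {n : ℕ}
    (M Q : Matrix (Fin n) (Fin n) F[X]) (s : Finset (Fin n))
    (hM : ∀ i ∈ s, M i = Q i) (hs : normalRank Q < s.card) : M.det = 0 := by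
  by_contra hdet
  have hinj := IsFractionRing.injective F[X] (FractionRing F[X])
  have hdet' : (M.map (algebraMap F[X] (FractionRing F[X]))).det ≠ 0 := by
    rw [← RingHom.mapMatrix_apply, ← RingHom.map_det]
    exact (map_ne_zero_iff _ hinj).2 hdet
  have hli := Matrix.linearIndependent_rows_of_det_ne_zero hdet'
  have hli' := (hli.comp (Subtype.val : s → Fin n) Subtype.val_injective).rank_matrix
  refine hs.not_ge ?_
  rw [← Fintype.card_coe s, ← hli']
  have : (fun i j => (M.map (algebraMap F[X] (FractionRing F[X]))).row (Subtype.val i) j :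
      Matrix s (Fin n) (FractionRing F[X])) =
      (Q.map (algebraMap F[X] (FractionRing F[X]))).submatrix Subtype.val id := by
    ext i j : 2
    simp [Matrix.row, hM i.1 i.2]
  exact (congrArg Matrix.rank this).trans_le (Matrix.rank_submatrix_le _ _ _)

theorem prod_initial_dvd_det_diagonal_add {F : Type*} [Field F] {n : ℕ}
    (γ : Fin n → F[X]) (hγ : ∀ i j, i ≤ j → γ i ∣ γ j) (Q : Matrix (Fin n) (Fin n) F[X]) :
    (∏ i : Fin n with i.val < n - normalRank Q, γ i) ∣ (Matrix.diagonal γ + Q).det := by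
  classical
  let f := (Matrix.detRowAlternating (R := F[X]) (n := Fin n)).toMultilinearMap
  let D : Fin n → Fin n → F[X] := Matrix.diagonal γ
  let q : Fin n → Fin n → F[X] := Q
  change _ ∣ f (D + q)
  -- In the summand of `s`, the rows in `s` come from `diagonal γ` and the others from `Q`.
  rw [f.map_add_univ]
  refine Finset.dvd_sum fun s _ => ?_
  by_cases hs : n - normalRank Q ≤ s.card
  · refine (prod_initial_dvd_prod γ hγ s hs).trans ?_
    -- Row `i` of `diagonal γ` is `γ i` times a unit row, so `γ i` factors out for each `i ∈ s`.
    let e : Fin n → Fin n → F[X] := (1 : Matrix (Fin n) (Fin n) F[X])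
    let m : Fin n → Fin n → F[X] := s.piecewise e q
    have hD : ∀ i, D i = γ i • e i := fun i => funext fun j => by
      simp [D, e, Matrix.diagonal_apply, Matrix.one_apply]
    have hm : s.piecewise D q = s.piecewise (fun i => γ i • m i) m := by
      ext i : 1
      by_cases hi : i ∈ s <;> simp [m, hi, hD]
    rw [hm, f.map_piecewise_smul]
    exact Dvd.intro _ rfl
  · have h0 : f (s.piecewise D q) = 0 := by
      refine det_eq_zero_of_normalRank_lt (s.piecewise D q) Q sᶜ (fun i hi => ?_) ?_
      · exact Finset.piecewise_eq_of_notMem _ _ _ (Finset.mem_compl.1 hi)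
      · rw [Finset.card_compl, Fintype.card_fin]; omega
    rw [h0]
    exact dvd_zero _

/-- The product of the first `n - rank Q` invariant factors of `G` divides `det (G + Q)`. -/
theorem IsInvariantFactors.prod_dvd_det_add {F : Type*} [Field F] {n : ℕ}
    {G : Matrix (Fin n) (Fin n) F[X]} {γ : Fin n → F[X]} (h : IsInvariantFactors G γ)
    (Q : Matrix (Fin n) (Fin n) F[X]) :
    (∏ i : Fin n with i.val < n - normalRank Q, γ i) ∣ (G + Q).det := by
  obtain ⟨U, V, hU, hV, hG⟩ := h.equiv
  have hUd := (Matrix.isUnit_iff_isUnit_det _).1 hU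
  have hVd := (Matrix.isUnit_iff_isUnit_det _).1 hV
  have hsum : G + Q = U * (Matrix.diagonal γ + U⁻¹ * Q * V⁻¹) * V := by
    rw [Matrix.mul_add, Matrix.add_mul, ← hG]
    congr 1
    rw [Matrix.mul_assoc, Matrix.mul_assoc, Matrix.mul_assoc, Matrix.nonsing_inv_mul _ hVd,
      Matrix.mul_one, ← Matrix.mul_assoc, Matrix.mul_nonsing_inv _ hUd, Matrix.one_mul]
  have hrank : normalRank (U⁻¹ * Q * V⁻¹) = normalRank Q := by
    have hu : ∀ W : Matrix (Fin n) (Fin n) F[X], IsUnit W →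
        IsUnit (W⁻¹.map (algebraMap F[X] (FractionRing F[X]))).det := fun W hW =>
      (Matrix.isUnit_iff_isUnit_det _).1
        (((Matrix.isUnit_nonsing_inv_iff).2 hW).map (algebraMap F[X] (FractionRing F[X])).mapMatrix)
    rw [normalRank, Matrix.map_mul, Matrix.map_mul,
      Matrix.rank_mul_eq_left_of_isUnit_det _ _ (hu V hV),
      Matrix.rank_mul_eq_right_of_isUnit_det _ _ (hu U hU), normalRank]
  rw [hsum, Matrix.det_mul, Matrix.det_mul, ← hrank]
  exact ((prod_initial_dvd_det_diagonal_add γ h.dvd _).mul_left _).mul_right _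

/-! ### Reversal of pencils: rank and determinant -/

theorem IsPencil.reversal_apply {F : Type*} [Field F] {n : ℕ} {G : Matrix (Fin n) (Fin n) F[X]}
    (hG : IsPencil G) (i j : Fin n) : reversal G i j = (G i j).reflect 1 := by
  have h := eq_X_add_C_of_degree_le_one (hG i j)
  conv_rhs => rw [h, reflect_add, reflect_C_mul, reflect_one_X, reflect_C]
  simp [reversal]
  ring

theorem reversal_add {F : Type*} [Field F] {n : ℕ} (G H : Matrix (Fin n) (Fin n) F[X]) :
    reversal (G + H) = reversal G + reversal H := by
  ext i j : 1
  simp only [reversal, Matrix.add_apply, Matrix.smul_apply, Matrix.map_apply, coeff_add, map_add,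
    smul_eq_mul]
  ring

/-- Reversing a pencil does not increase its normal rank: substitute `1 / s` for `s`. -/
theorem IsPencil.normalRank_reversal_le {F : Type*} [Field F] {n : ℕ}
    {G : Matrix (Fin n) (Fin n) F[X]} (hG : IsPencil G) :
    normalRank (reversal G) ≤ normalRank G := by
  let K := FractionRing F[X]
  let a : F[X] →+* K := algebraMap F[X] K
  have ha : Function.Injective a := IsFractionRing.injective F[X] K
  have hx : a X ≠ 0 := (map_ne_zero_iff a ha).2 X_ne_zero
  let φ : F[X] →+* K := eval₂RingHom (a.comp C) (a X)⁻¹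
  let _ : Invertible (a X) := invertibleOfNonzero hx
  have hid : ∀ p : F[X], eval₂ (a.comp C) (a X) p = a p := fun p => by
    rw [← hom_eval₂]; simp
  -- `φ` substitutes `1 / s` for `s`; up to a power of `s`, `φ p` is the reflection of `p`, so it
  -- vanishes only for `p = 0`. Hence `φ` extends to the fraction field.
  have hφ : Function.Injective φ := by
    rw [injective_iff_map_eq_zero]
    intro p hp
    have h1 := eval₂_reflect_eq_zero_iff (a.comp C) (a X) p.natDegree (p.reflect p.natDegree)
      (natDegree_reflect_le.trans (by simp))
    rw [reflect_reflect, hid, invOf_eq_inv] at h1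
    exact reflect_eq_zero_iff.1 ((map_eq_zero_iff a ha).1 (h1.1 hp))
  let ψ : K →+* K := IsFractionRing.lift hφ
  have hψ : ∀ p, ψ (a p) = φ p := fun p => IsFractionRing.lift_algebraMap hφ p
  -- This is the identity `reversal G (s) = s * G (1 / s)`; the scalar `s` is invertible and does
  -- not affect the rank.
  have hrev : (reversal G).map a = a X • (G.map a).map ψ := by
    ext i j : 2
    rw [Matrix.map_apply, Matrix.smul_apply, Matrix.map_apply, Matrix.map_apply, hψ,
      hG.reversal_apply, ← hid, smul_eq_mul]
    have h := eval₂_reflect_mul_pow (a.comp C) (a X) 1 ((G i j).reflect 1)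
      (natDegree_reflect_le.trans (max_le le_rfl (natDegree_le_of_degree_le (hG i j))))
    rw [reflect_reflect, invOf_eq_inv, pow_one] at h
    rw [← h, mul_comm]
    rfl
  change ((reversal G).map a).rank ≤ (G.map a).rank
  rw [hrev, Matrix.rank_smul_of_mem_nonZeroDivisors _ (mem_nonZeroDivisors_of_ne_zero hx)]
  exact Matrix.rank_map_ringHom_le ψ _

theorem natDegree_prod_le_card {ι F : Type*} [Field F] (s : Finset ι) (f : ι → F[X])
    (hf : ∀ i ∈ s, (f i).natDegree ≤ 1) : (∏ i ∈ s, f i).natDegree ≤ s.card :=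
  (natDegree_prod_le s f).trans ((Finset.sum_le_sum hf).trans (by simp))

theorem reflect_prod_of_natDegree_le_one {ι F : Type*} [Field F] (s : Finset ι) (f : ι → F[X])
    (hf : ∀ i ∈ s, (f i).natDegree ≤ 1) :
    (∏ i ∈ s, f i).reflect s.card = ∏ i ∈ s, (f i).reflect 1 := by
  classical
  induction s using Finset.induction_on with
  | empty => simp
  | insert i s hi ih =>
    have hs : ∀ j ∈ s, (f j).natDegree ≤ 1 := fun j hj => hf j (Finset.mem_insert_of_mem hj)
    rw [Finset.prod_insert hi, Finset.prod_insert hi, Finset.card_insert_of_notMem hi, add_comm,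
      reflect_mul _ _ (hf i (Finset.mem_insert_self _ _)) (natDegree_prod_le_card s f hs), ih hs]

theorem IsPencil.natDegree_det_le {F : Type*} [Field F] {n : ℕ}
    {G : Matrix (Fin n) (Fin n) F[X]} (hG : IsPencil G) : G.det.natDegree ≤ n := by
  rw [Matrix.det_apply]
  refine natDegree_sum_le_of_forall_le _ _ fun σ _ => (natDegree_smul_le _ _).trans ?_
  simpa using natDegree_prod_le_card Finset.univ (fun i => G (σ i) i)
    fun i _ => natDegree_le_of_degree_le (hG _ _)

/-- Each Leibniz term is a product of `n` entries of degree at most one, so reflecting it at `n`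
reflects every entry at `1`; reflection is additive. -/
theorem IsPencil.det_reversal {F : Type*} [Field F] {n : ℕ}
    {G : Matrix (Fin n) (Fin n) F[X]} (hG : IsPencil G) :
    (reversal G).det = G.det.reflect n := by
  let ρ : F[X] →+ F[X] := AddMonoidHom.mk' (reflect n) fun f g => reflect_add f g n
  change _ = ρ G.det
  rw [Matrix.det_apply, Matrix.det_apply, map_sum]
  refine Finset.sum_congr rfl fun σ _ => ?_
  have h := reflect_prod_of_natDegree_le_one Finset.univ (fun i => G (σ i) i)
    fun i _ => natDegree_le_of_degree_le (hG _ _)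
  rw [Finset.card_univ, Fintype.card_fin] at h
  rw [Units.smul_def, Units.smul_def, map_zsmul]
  congr 1
  simp only [hG.reversal_apply]
  exact h.symm

/-! ### Orders of vanishing at zero and the conclusion -/

theorem rootMultiplicity_zero_reflect_le {F : Type*} [Field F] {n : ℕ} {p : F[X]} (hp : p ≠ 0)
    (hn : p.natDegree ≤ n) : (p.reflect n).rootMultiplicity 0 ≤ n - p.natDegree := by
  rw [rootMultiplicity_eq_natTrailingDegree']
  refine natTrailingDegree_le_of_ne_zero ?_
  -- The coefficient of index `n - p.natDegree` in the reflection is the leading coefficient of `p`.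
  rw [coeff_reflect, revAt_le (Nat.sub_le _ _), Nat.sub_sub_self hn]
  exact leadingCoeff_ne_zero.2 hp

theorem rootMultiplicity_prod {ι F : Type*} [Field F] (s : Finset ι) (f : ι → F[X]) (a : F)
    (hf : ∏ i ∈ s, f i ≠ 0) :
    (∏ i ∈ s, f i).rootMultiplicity a = ∑ i ∈ s, (f i).rootMultiplicity a := by
  classical
  induction s using Finset.induction_on with
  | empty => simp
  | insert i s hi ih =>
    rw [Finset.prod_insert hi] at hf
    rw [Finset.prod_insert hi, Finset.sum_insert hi, rootMultiplicity_mul hf,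
      ih (right_ne_zero_of_mul hf)]

theorem algMultInfty_eq_sum_add_topMultInfty {F : Type*} [Field F] {n : ℕ} (r : ℕ)
    (G : Matrix (Fin n) (Fin n) F[X]) :
    algMultInfty G =
      (∑ i : Fin n with i.val < n - r, partialMultInfty G i) + topMultInfty r G := by
  rw [algMultInfty, topMultInfty, ← Finset.sum_filter_add_sum_filter_not _ fun i : Fin n =>
    i.val < n - r]
  simp only [not_lt]

theorem proposition5p1 {F : Type*} [Field F] {n r : ℕ}
    (A P : Matrix (Fin n) (Fin n) F[X])
    (hA : IsRegularPencil A) (hP : IsPencil P) (hr : normalRank P = r)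
    (hAP : IsRegularPencil (A + P)) :
    (∏ i : Fin n with i.val < n - r, invariantFactor A i) ∣ (A + P).det ∧
      (algMultInfty A : ℤ) - (topMultInfty r A : ℤ) ≤ (n : ℤ) - ((A + P).det.natDegree : ℤ) := by
  subst hr
  refine ⟨(isInvariantFactors_invariantFactor A).prod_dvd_det_add P, ?_⟩
  have hdeg := hAP.1.natDegree_det_le
  have hdvd := (isInvariantFactors_invariantFactor (reversal A)).prod_dvd_det_add (reversal P)
  rw [← reversal_add, hAP.1.det_reversal] at hdvd
  -- A smaller rank for `reversal P` only lengthens the product in `hdvd`, so the shorter product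
  -- still divides.
  have hsub : (∏ i : Fin n with i.val < n - normalRank P, invariantFactor (reversal A) i) ∣
      (A + P).det.reflect n := by
    refine (Finset.prod_dvd_prod_of_subset _ _ _ fun i hi => ?_).trans hdvd
    have := hP.normalRank_reversal_le
    simp only [Finset.mem_filter, Finset.mem_univ, true_and] at hi ⊢
    omega
  have hne : (A + P).det.reflect n ≠ 0 := fun h => hAP.2 (reflect_eq_zero_iff.1 h)
  have hle := (rootMultiplicity_le_rootMultiplicity_of_dvd hne hsub 0).trans
    (rootMultiplicity_zero_reflect_le hAP.2 hdeg)
  rw [rootMultiplicity_prod _ _ _ (ne_zero_of_dvd_ne_zero hne hsub)] at hle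
  have hsplit := algMultInfty_eq_sum_add_topMultInfty (normalRank P) A
  simp only [partialMultInfty] at hsplit
  -- By `hdeg` the truncated subtraction `n - natDegree` in `hle` agrees with the integer one.
  omega
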